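/- There is an absolute constant $C_1>0$ such that the following holds. Let $N\ge 1$, $n\ge 0$ be integers and let $A\ge 0$, $c\ge 0$, $d\ge 1$, $u$, $C,D,\varepsilon,\delta>0$ and $H$ be real numbers with $ud\ge 1$ and $\ln(N/\delta)\ge 3$. Put $\widetilde\alpha_{k+1}=D(k+2)$, and let $\alpha_k\ge 0$ and $\sigma_k>0$ ($k\ge 0$) be deterministic numbers with $$\alpha_{k+1}\le\widetilde\alpha_{k+1},\qquad \sigma_k^2\le\frac{C\varepsilon}{\widetilde\alpha_{k+1}\ln(N/\delta)}\qquad\text{for all }k\ge 0 .$$ On a probability space let $R_k\ge 0$ be random variables and $\eta^k,a^k$ random vectors in $\mathbb R^n$ ($k\ge 0$), and put $\widetilde R_0=R_0$, $\widetilde R_k=\max\{\widetilde R_{k-1},R_k\}$ for $k\ge1$. Assume, almost surely and for all $k\ge 0$: - $\widetilde R_k$ and $a^k$ are measurable functions of $\eta^0,\dots,\eta^k$, and $\|a^k\|_2\le d\widetilde R_k$; - $\mathbb E[\eta^k\mid \eta^0,\dots,\eta^{k-1}]=0$ and $\mathbb E[\exp(\|\eta^k\|_2^2/\sigma_k^2)\mid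 \eta^0,\dots,\eta^{k-1}]\le \exp(1)$; - $\varepsilon\le HR_0^2/N^2$; - for all $l=1,\dots,N$, $$\tfrac12R_l^2\le A+u\sum_{k=0}^{l-1}\alpha_{k+1}\langle\eta^{k+1},a^k\rangle+c\sum_{k=0}^{l-1}\alpha_{k+1}^2\|\eta^{k+1}\|_2^2 .$$ Then with probability at least $1-2\delta$ the inequalities $$\widetilde R_l\le JR_0\qquad\text{and}\qquad u\sum_{k=0}^{l-1}\alpha_{k+1}\langle\eta^{k+1},a^k\rangle+c\sum_{k=0}^{l-1}\alpha_{k+1}^2\|\eta^{k+1}\|_2^2\le\Big(24cCDH+udC_1\sqrt{CDHJ^2g(N)}\Big)R_0^2$$ hold for all $l=1,\dots,N$ simultaneously, where $$g(N)=\frac{\ln(N/\delta)+\ln\ln(B/b)}{\ln(N/\delta)},\qquad b=\sigma_0^2\widetilde\alpha_1^2d^2R_0^2,$$ $$B=2d^2CDHR_0^2\big(2A+udR_0^2+12CD\varepsilon(2c+ud)N(N+3)\big)(2ud)^N,$$ $$J=\max\Big\{1,\ udC_1\sqrt{CDHg(N)}+\sqrt{u^2d^2C_1^2CDHg(N)+\tfrac{2A}{R_0^2}+48cCDH}\Big\}.$$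 -/

import Mathlib

open MeasureTheory

noncomputable section

/-- The running maximum: `r̃ 0 = r 0` and `r̃ (k+1) = max (r̃ k) (r (k+1))`. -/
def runningMax (r : ℕ → ℝ) : ℕ → ℝ
  | 0 => r 0
  | k + 1 => max (runningMax r k) (r (k + 1))

/-- The sigma-algebra generated by the first `k` variables `η 0, …, η (k-1)`
(the trivial one for `k = 0`). -/
abbrev sigmaBefore {Ω E : Type*} [MeasurableSpace E] (η : ℕ → Ω → E) (k : ℕ) :
    MeasurableSpace Ω :=
  ⨆ j : Fin k, MeasurableSpace.comap (η j) inferInstance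

/-- The majorant of the step sizes, `α̃ k = D (k + 1)`, i.e. `α̃ (k+1) = D (k + 2)`. -/
def alphaTilde (D : ℝ) (k : ℕ) : ℝ := D * ((k : ℝ) + 1)

/-- The quantity `B`, as a function of the initial radius `r₀`. -/
def upperB (A u c d C D H ε : ℝ) (N : ℕ) (r₀ : ℝ) : ℝ :=
  2 * d ^ 2 * C * D * H * r₀ ^ 2 *
    (2 * A + u * d * r₀ ^ 2 + 12 * C * D * ε * (2 * c + u * d) * N * (N + 3)) *
    (2 * u * d) ^ N

/-- The quantity `b`, as a function of `σ 0` and of the initial radius `r₀`. -/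
def lowerB (d D σ₀ r₀ : ℝ) : ℝ := σ₀ ^ 2 * alphaTilde D 1 ^ 2 * d ^ 2 * r₀ ^ 2

/-- `(ln(N/δ) + ln ln(B/b)) / ln(N/δ)`. -/
def gFactor (N : ℕ) (δ B b : ℝ) : ℝ :=
  (Real.log (N / δ) + Real.log (Real.log (B / b))) / Real.log (N / δ)

/-- The factor `J` bounding the growth of the radii. -/
def radiusFactor (A u c d C D H C₁ g r₀ : ℝ) : ℝ :=
  max 1 (u * d * C₁ * √(C * D * H * g) +
    √(u ^ 2 * d ^ 2 * C₁ ^ 2 * C * D * H * g + 2 * A / r₀ ^ 2 + 48 * c * C * D * H))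

end

/-! Cut each `a k` off at the level `d * J * R 0` that it is expected to respect and divide by that
level. The resulting vectors have norm at most one and are known before `η (k + 1)`, so their
weighted inner products with the noise form a martingale with a deterministic variance bound. A
Chernoff bound, together with a Markov bound on each noise norm, fails with probability at most `δ /
N` for each index; two union bounds give `2 * δ`.

Outside these events the argument is deterministic (`radius_le_and_sum_le`). As long as the earlier
radii are at most `J * R 0` the cut-off is inactive, so the martingale bound applies to the original
sum, and the recurrence bounds the next radius because `J ^ 2` dominates `2 * P * J + Q`. Since the
variance bound is deterministic after rescaling, no iterated logarithm is needed: `g` enters only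
through `1 ≤ g`. -/

/-! ### Conditional moment generating functions -/

theorem Real.exp_le_self_add_exp_sq (x : ℝ) : Real.exp x ≤ x + Real.exp (x ^ 2) := by
  rcases le_or_gt |x| 1 with h | h
  · have h₁ := (abs_le.1 (Real.abs_exp_sub_one_sub_id_le h)).2
    linarith [Real.add_one_le_exp (x ^ 2)]
  · rcases lt_abs.1 h with h | h
    · have : Real.exp x ≤ Real.exp (x ^ 2) := Real.exp_le_exp.2 (by nlinarith)
      linarith
    · have h₁ : Real.exp x ≤ 1 := Real.exp_le_one_iff.2 (by linarith)
      nlinarith [Real.add_one_le_exp (x ^ 2)]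

/-- If `x ^ 2 ≤ s * y` then `exp x` is at most an affine function of `x` and `exp y`, whose
value at `x = 0`, `y = 1` is `exp s`. -/
theorem Real.exists_exp_le_affine {s : ℝ} (hs : 0 ≤ s) :
    ∃ p q : ℝ, 0 ≤ q ∧ ∀ x y : ℝ, 0 ≤ y → x ^ 2 ≤ s * y →
      Real.exp x ≤ p * x + Real.exp s * (1 + q * (Real.exp (y - 1) - 1)) := by
  -- Convexity: `exp` lies below its chord between `0` and `z`.
  have key : ∀ t z : ℝ, 0 ≤ t → t ≤ 1 → Real.exp (t * z) ≤ 1 + t * (Real.exp z - 1) := by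
    intro t z h0 h1
    have := convexOn_exp.2 (Set.mem_univ z) (Set.mem_univ 0) h0 (sub_nonneg.2 h1) (by ring)
    simp only [smul_eq_mul, mul_zero, add_zero, Real.exp_zero] at this
    linarith
  rcases le_or_gt s 1 with h | h
  · refine ⟨1, s, hs, fun x y _ hxy => ?_⟩
    calc Real.exp x ≤ x + Real.exp (x ^ 2) := Real.exp_le_self_add_exp_sq x
      _ ≤ x + Real.exp (s * y) := by gcongr
      _ = 1 * x + Real.exp s * Real.exp (s * (y - 1)) := by rw [← Real.exp_add]; ring_nf
      _ ≤ _ := by gcongr; exact key s _ hs h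
  · refine ⟨0, 1 / 2, by norm_num, fun x y hy hxy => ?_⟩
    -- By the arithmetic-geometric mean inequality `x ≤ (s + y) / 2`, and `1 < s` absorbs the rest.
    -- No linear term is needed here.
    have hx : x ≤ s + 1 / 2 * (y - 1) := by nlinarith [sq_nonneg (s - y), sq_nonneg (s + y - 2 * x)]
    calc Real.exp x ≤ Real.exp (s + 1 / 2 * (y - 1)) := by gcongr
      _ = 0 * x + Real.exp s * Real.exp (1 / 2 * (y - 1)) := by rw [Real.exp_add]; ring
      _ ≤ _ := by gcongr; exact key _ _ (by norm_num) (by norm_num)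

/-- On `m` the measure with density `W` is at most `c • μ`; integrate `Z` against both. This
replaces pulling `Z` out of a conditional expectation and needs no integrability of the product. -/
theorem lintegral_mul_le_of_setLIntegral_le {Ω : Type*} {m m₀ : MeasurableSpace Ω}
    {μ : Measure Ω} (hm : m ≤ m₀) {W Z : Ω → ENNReal} {c : ENNReal} (hW : Measurable W)
    (hZ : Measurable[m] Z)
    (h : ∀ s, MeasurableSet[m] s → ∫⁻ ω in s, W ω ∂μ ≤ c * μ s) :
    ∫⁻ ω, W ω * Z ω ∂μ ≤ c * ∫⁻ ω, Z ω ∂μ := by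
  have hle : (μ.withDensity W).trim hm ≤ c • μ.trim hm := by
    refine Measure.le_iff.2 fun s hs => ?_
    rw [trim_measurableSet_eq hm hs, withDensity_apply _ (hm s hs), Measure.smul_apply,
      trim_measurableSet_eq hm hs]
    exact h s hs
  calc ∫⁻ ω, W ω * Z ω ∂μ = ∫⁻ ω, Z ω ∂(μ.withDensity W) :=
        (lintegral_withDensity_eq_lintegral_mul μ hW (hZ.mono hm le_rfl)).symm
    _ = ∫⁻ ω, Z ω ∂((μ.withDensity W).trim hm) := (lintegral_trim hm hZ).symm
    _ ≤ ∫⁻ ω, Z ω ∂(c • μ.trim hm) := lintegral_mono' hle le_rfl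
    _ = c * ∫⁻ ω, Z ω ∂μ := by rw [lintegral_smul_measure, lintegral_trim hm hZ, smul_eq_mul]

/-- A vector with a light-tailed norm has moments of order one. -/
theorem integrable_of_integrable_exp_sq {Ω E : Type*} [NormedAddCommGroup E]
    {m₀ : MeasurableSpace Ω} {μ : Measure Ω} [IsFiniteMeasure μ] {ξ : Ω → E} {s : ℝ} (hs : 0 < s) (hξ : AEStronglyMeasurable ξ μ)
    (hexp : Integrable (fun ω => Real.exp (‖ξ ω‖ ^ 2 / s ^ 2)) μ) : Integrable ξ μ := by
  refine (hexp.const_mul s).mono' hξ (Filter.Eventually.of_forall fun ω => ?_)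
  have h₁ := Real.add_one_le_exp (‖ξ ω‖ ^ 2 / s ^ 2)
  have h₂ : ‖ξ ω‖ / s ≤ ‖ξ ω‖ ^ 2 / s ^ 2 + 1 := by
    rw [← div_pow]; nlinarith [sq_nonneg (‖ξ ω‖ / s - 1), sq_nonneg (‖ξ ω‖ / s)]
  rw [mul_comm, ← div_le_iff₀ hs]
  exact h₂.trans h₁

/-- The conditional moment generating function of a light-tailed centred vector. -/
theorem setLIntegral_exp_inner_le {Ω E : Type*} [NormedAddCommGroup E]
    [InnerProductSpace ℝ E] [CompleteSpace E] {m m₀ : MeasurableSpace Ω} {μ : Measure Ω}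
    [IsFiniteMeasure μ] (hm : m ≤ m₀) {ξ v : Ω → E} {s β : ℝ} (hs : 0 < s)
    (hξ : Integrable ξ μ) (hmean : μ[ξ | m] =ᵐ[μ] 0)
    (hexp : Integrable (fun ω => Real.exp (‖ξ ω‖ ^ 2 / s ^ 2)) μ)
    (htail : ∀ᵐ ω ∂μ, (μ[fun ω' => Real.exp (‖ξ ω'‖ ^ 2 / s ^ 2) | m]) ω ≤ Real.exp 1)
    (hv : StronglyMeasurable[m] v) (hβ : ∀ ω, ‖v ω‖ ≤ β) {S : Set Ω} (hS : MeasurableSet[m] S) :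
    ∫⁻ ω in S, ENNReal.ofReal (Real.exp (inner ℝ (ξ ω) (v ω))) ∂μ ≤
      ENNReal.ofReal (Real.exp (β ^ 2 * s ^ 2)) * μ S := by
  obtain ⟨p, q, hq, hpq⟩ := Real.exists_exp_le_affine (s := β ^ 2 * s ^ 2) (by positivity)
  have hinner_int : Integrable (fun ω => (inner ℝ (ξ ω) (v ω) : ℝ)) μ := by
    refine (hξ.norm.mul_const β).mono'
      (hξ.1.inner (hv.mono hm).aestronglyMeasurable) (Filter.Eventually.of_forall fun ω => ?_)
    exact (norm_inner_le_norm _ _).trans (by gcongr; exact hβ ω)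
  have hinner : ∫ ω in S, (inner ℝ (ξ ω) (v ω) : ℝ) ∂μ = 0 := by
    rw [← setIntegral_condExp hm hinner_int hS]
    have h := condExp_stronglyMeasurable_bilin_of_bound (μ := μ) (innerSL ℝ (E := E)) hm hv hξ β
      (Filter.Eventually.of_forall hβ)
    have h' : μ[fun ω => (inner ℝ (ξ ω) (v ω) : ℝ) | m] =ᵐ[μ] 0 := by
      have : (fun ω => (inner ℝ (ξ ω) (v ω) : ℝ)) = fun ω => innerSL ℝ (v ω) (ξ ω) := by
        ext ω; simp [real_inner_comm]
      rw [this]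
      filter_upwards [h, hmean] with ω h₁ h₂
      rw [h₁, h₂]; simp
    rw [integral_congr_ae (ae_restrict_of_ae h')]
    simp
  set Y : Ω → ℝ := fun ω => Real.exp (‖ξ ω‖ ^ 2 / s ^ 2) with hY
  have hYle : ∫ ω in S, Y ω ∂μ ≤ Real.exp 1 * μ.real S := by
    rw [← setIntegral_condExp hm hexp hS]
    calc ∫ ω in S, (μ[Y | m]) ω ∂μ ≤ ∫ _ in S, Real.exp 1 ∂μ :=
          integral_mono_ae integrable_condExp.integrableOn (integrable_const _)
            (ae_restrict_of_ae htail)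
      _ = _ := by simp [mul_comm]
  -- Affine majorant of the exponential: over `S` its linear term integrates to zero and `exp (-1) *
  -- Y` to at most `μ S`.
  set G : Ω → ℝ := fun ω => p * inner ℝ (ξ ω) (v ω) +
    Real.exp (β ^ 2 * s ^ 2) * (1 + q * (Real.exp (-1) * Y ω - 1)) with hG
  have hle : ∀ ω, Real.exp (inner ℝ (ξ ω) (v ω)) ≤ G ω := by
    intro ω
    have h := hpq (inner ℝ (ξ ω) (v ω)) (‖ξ ω‖ ^ 2 / s ^ 2) (by positivity) (by
      have h₁ := (abs_real_inner_le_norm (ξ ω) (v ω)).trans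
        (mul_le_mul_of_nonneg_left (hβ ω) (norm_nonneg _))
      calc (inner ℝ (ξ ω) (v ω) : ℝ) ^ 2 = |inner ℝ (ξ ω) (v ω)| ^ 2 := (sq_abs _).symm
        _ ≤ (‖ξ ω‖ * β) ^ 2 := by gcongr
        _ = _ := by field_simp)
    rw [sub_eq_neg_add (‖ξ ω‖ ^ 2 / s ^ 2), Real.exp_add] at h
    exact h
  have hY' : IntegrableOn Y S μ := hexp.integrableOn
  have hG0 : IntegrableOn (fun ω => Real.exp (-1) * Y ω - 1) S μ :=
    (hY'.const_mul _).sub (integrable_const _)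
  have hG1 : IntegrableOn (fun ω => 1 + q * (Real.exp (-1) * Y ω - 1)) S μ :=
    (integrable_const _).add (hG0.const_mul _)
  have hGint : IntegrableOn G S μ :=
    (hinner_int.integrableOn.const_mul _).add (hG1.const_mul _)
  have hGval : ∫ ω in S, G ω ∂μ ≤ Real.exp (β ^ 2 * s ^ 2) * μ.real S := by
    rw [hG, integral_add (hinner_int.integrableOn.const_mul _) (hG1.const_mul _),
      integral_const_mul, integral_const_mul, hinner,
      integral_add (integrable_const _) (hG0.const_mul _),
      integral_const_mul, integral_sub (hY'.const_mul _) (integrable_const _),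
      integral_const_mul]
    simp only [mul_zero, zero_add, integral_const, measureReal_restrict_apply_univ, smul_eq_mul,
      mul_one]
    have h₁ : Real.exp (-1) * ∫ ω in S, Y ω ∂μ ≤ μ.real S := by
      calc _ ≤ Real.exp (-1) * (Real.exp 1 * μ.real S) := by gcongr
        _ = μ.real S := by rw [← mul_assoc, ← Real.exp_add]; simp
    have h₂ : q * (Real.exp (-1) * ∫ ω in S, Y ω ∂μ - μ.real S) ≤ 0 :=
      mul_nonpos_of_nonneg_of_nonpos hq (by linarith)
    gcongr
    linarith
  calc ∫⁻ ω in S, ENNReal.ofReal (Real.exp (inner ℝ (ξ ω) (v ω))) ∂μ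
      ≤ ∫⁻ ω in S, ENNReal.ofReal (G ω) ∂μ :=
        lintegral_mono fun ω => ENNReal.ofReal_le_ofReal (hle ω)
    _ = ENNReal.ofReal (∫ ω in S, G ω ∂μ) :=
        (ofReal_integral_eq_lintegral_ofReal hGint
          (Filter.Eventually.of_forall fun ω => (Real.exp_pos _).le.trans (hle ω))).symm
    _ ≤ ENNReal.ofReal (Real.exp (β ^ 2 * s ^ 2) * μ.real S) := ENNReal.ofReal_le_ofReal hGval
    _ = _ := by rw [ENNReal.ofReal_mul (Real.exp_pos _).le, ofReal_measureReal]

/-! ### The filtration generated by the noise -/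

section Filtration

variable {Ω E : Type*} [MeasurableSpace E] {η : ℕ → Ω → E}

theorem sigmaBefore_le [m₀ : MeasurableSpace Ω] (hη : ∀ k, Measurable (η k)) (k : ℕ) :
    sigmaBefore η k ≤ m₀ :=
  iSup_le fun j => (hη j).comap_le

theorem measurable_sigmaBefore {j k : ℕ} (h : j < k) : Measurable[sigmaBefore η k] (η j) :=
  Measurable.of_comap_le (le_iSup (fun i : Fin k =>
    MeasurableSpace.comap (η i) (inferInstance : MeasurableSpace E)) ⟨j, h⟩)

theorem sigmaBefore_mono {j k : ℕ} (h : j ≤ k) : sigmaBefore η j ≤ sigmaBefore η k :=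
  iSup_le fun i => (measurable_sigmaBefore (i.2.trans_le h)).comap_le

end Filtration

/-! ### Tail bounds for the noise and the martingale -/

section Tails

/-- Markov's inequality for `exp (‖ξ‖ ^ 2 / s ^ 2)`, whose mean is at most `exp 1`. -/
theorem measure_sq_norm_gt_le {Ω E : Type*} [NormedAddCommGroup E] {m m₀ : MeasurableSpace Ω}
    {μ : Measure Ω} [IsProbabilityMeasure μ] (hm : m ≤ m₀) {ξ : Ω → E} {s L : ℝ} (hs : 0 < s)
    (hexp : Integrable (fun ω => Real.exp (‖ξ ω‖ ^ 2 / s ^ 2)) μ)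
    (htail : ∀ᵐ ω ∂μ, (μ[fun ω' => Real.exp (‖ξ ω'‖ ^ 2 / s ^ 2) | m]) ω ≤ Real.exp 1) :
    μ {ω | s ^ 2 * (1 + L) < ‖ξ ω‖ ^ 2} ≤ ENNReal.ofReal (Real.exp (-L)) := by
  have h₁ : ∫ ω, Real.exp (‖ξ ω‖ ^ 2 / s ^ 2) ∂μ ≤ Real.exp 1 := by
    rw [← integral_condExp hm]
    calc _ ≤ ∫ _, Real.exp 1 ∂μ := integral_mono_ae integrable_condExp (integrable_const _) htail
      _ = _ := by simp
  have h₂ := mul_meas_ge_le_integral_of_nonneg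
    (Filter.Eventually.of_forall fun ω => (Real.exp_pos (‖ξ ω‖ ^ 2 / s ^ 2)).le) hexp
    (Real.exp (1 + L))
  have h₃ : μ.real {ω | Real.exp (1 + L) ≤ Real.exp (‖ξ ω‖ ^ 2 / s ^ 2)} ≤ Real.exp (-L) := by
    refine le_of_mul_le_mul_left ((h₂.trans h₁).trans_eq ?_) (Real.exp_pos (1 + L))
    rw [← Real.exp_add]; ring_nf
  calc _ ≤ μ {ω | Real.exp (1 + L) ≤ Real.exp (‖ξ ω‖ ^ 2 / s ^ 2)} := by
        refine measure_mono fun ω hω => Real.exp_le_exp.2 ?_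
        rw [le_div_iff₀ (by positivity), mul_comm]
        exact le_of_lt hω
    _ ≤ _ := by rw [← ofReal_measureReal]; exact ENNReal.ofReal_le_ofReal h₃

variable {Ω E : Type*} [MeasurableSpace Ω] {μ : Measure Ω} [NormedAddCommGroup E]
  [InnerProductSpace ℝ E] [CompleteSpace E] [MeasurableSpace E] [BorelSpace E] [SecondCountableTopology E]

/-- The moment generating function of a martingale with light-tailed increments. -/
theorem lintegral_exp_sum_inner_le [IsProbabilityMeasure μ] {η v : ℕ → Ω → E} {σ β : ℕ → ℝ}
    (hσ : ∀ k, 0 < σ k) (hη : ∀ k, Measurable (η k))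
    (hmean : ∀ k, μ[η k | sigmaBefore η k] =ᵐ[μ] 0)
    (hexp : ∀ k, Integrable (fun ω => Real.exp (‖η k ω‖ ^ 2 / σ k ^ 2)) μ)
    (htail : ∀ k, ∀ᵐ ω ∂μ,
      (μ[fun ω' => Real.exp (‖η k ω'‖ ^ 2 / σ k ^ 2) | sigmaBefore η k]) ω ≤ Real.exp 1)
    (hv : ∀ k, Measurable[sigmaBefore η (k + 1)] (v k)) (hβ : ∀ k ω, ‖v k ω‖ ≤ β k) (l : ℕ) :
    ∫⁻ ω, ENNReal.ofReal (Real.exp (∑ k ∈ Finset.range l, inner ℝ (η (k + 1) ω) (v k ω))) ∂μ ≤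
      ENNReal.ofReal (Real.exp (∑ k ∈ Finset.range l, β k ^ 2 * σ (k + 1) ^ 2)) := by
  induction l with
  | zero => simp
  | succ l ih =>
    have hm := sigmaBefore_le hη (l + 1)
    have hZ : Measurable[sigmaBefore η (l + 1)] fun ω =>
        ENNReal.ofReal (Real.exp (∑ k ∈ Finset.range l, inner ℝ (η (k + 1) ω) (v k ω))) := by
      refine ENNReal.measurable_ofReal.comp (Real.measurable_exp.comp
        (Finset.measurable_fun_sum _ fun k hk => ?_))
      have hk := Finset.mem_range.1 hk
      exact Measurable.inner (measurable_sigmaBefore (by omega))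
        ((hv k).mono (sigmaBefore_mono (by omega)) le_rfl)
    have hW : Measurable fun ω =>
        ENNReal.ofReal (Real.exp (inner ℝ (η (l + 1) ω) (v l ω))) :=
      ENNReal.measurable_ofReal.comp (Real.measurable_exp.comp
        ((hη _).inner ((hv l).mono hm le_rfl)))
    have hstep := lintegral_mul_le_of_setLIntegral_le (μ := μ) hm hW hZ fun S hS =>
      setLIntegral_exp_inner_le hm (hσ (l + 1))
        (integrable_of_integrable_exp_sq (hσ (l + 1)) (hη _).aestronglyMeasurable (hexp _))
        (hmean _) (hexp _) (htail _) (hv l).stronglyMeasurable (hβ l) hS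
    simp only [Finset.sum_range_succ, Real.exp_add]
    calc _ = _ := lintegral_congr fun ω => by
          rw [mul_comm, ENNReal.ofReal_mul (Real.exp_pos _).le]
      _ ≤ _ := hstep
      _ ≤ _ := mul_le_mul_right ih _
      _ = _ := by rw [mul_comm, ENNReal.ofReal_mul (Real.exp_pos _).le]

/-- Chernoff's bound with exponent one; the free parameter is to be absorbed into `v` and `β`. -/
theorem measure_sum_inner_gt_le [IsProbabilityMeasure μ] {η v : ℕ → Ω → E} {σ β : ℕ → ℝ}
    (hσ : ∀ k, 0 < σ k) (hη : ∀ k, Measurable (η k))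
    (hmean : ∀ k, μ[η k | sigmaBefore η k] =ᵐ[μ] 0)
    (hexp : ∀ k, Integrable (fun ω => Real.exp (‖η k ω‖ ^ 2 / σ k ^ 2)) μ)
    (htail : ∀ k, ∀ᵐ ω ∂μ,
      (μ[fun ω' => Real.exp (‖η k ω'‖ ^ 2 / σ k ^ 2) | sigmaBefore η k]) ω ≤ Real.exp 1)
    (hv : ∀ k, Measurable[sigmaBefore η (k + 1)] (v k)) (hβ : ∀ k ω, ‖v k ω‖ ≤ β k) (l : ℕ)
    (x : ℝ) :
    μ {ω | x < ∑ k ∈ Finset.range l, inner ℝ (η (k + 1) ω) (v k ω)} ≤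
      ENNReal.ofReal (Real.exp (∑ k ∈ Finset.range l, β k ^ 2 * σ (k + 1) ^ 2 - x)) := by
  have hmeas : Measurable fun ω => ENNReal.ofReal
      (Real.exp (∑ k ∈ Finset.range l, inner ℝ (η (k + 1) ω) (v k ω))) := by
    refine ENNReal.measurable_ofReal.comp (Real.measurable_exp.comp
      (Finset.measurable_fun_sum _ fun k _ => ?_))
    exact (hη _).inner ((hv k).mono (sigmaBefore_le hη _) le_rfl)
  have h := (mul_meas_ge_le_lintegral hmeas (ENNReal.ofReal (Real.exp x)) (μ := μ)).trans
    (lintegral_exp_sum_inner_le hσ hη hmean hexp htail hv hβ l)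
  have hx : ENNReal.ofReal (Real.exp x) ≠ 0 := by simp [Real.exp_pos]
  rw [Real.exp_sub, ENNReal.ofReal_div_of_pos (Real.exp_pos _),
    ENNReal.le_div_iff_mul_le (Or.inl hx) (Or.inl ENNReal.ofReal_ne_top), mul_comm]
  refine le_trans (mul_le_mul_right (measure_mono fun ω hω => ?_) _) h
  exact ENNReal.ofReal_le_ofReal (Real.exp_le_exp.2 (le_of_lt hω))

end Tails

/-! ### Running maximum and the constants -/

theorem le_runningMax (r : ℕ → ℝ) (k : ℕ) : r k ≤ runningMax r k := by
  cases k with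
  | zero => exact le_rfl
  | succ k => exact le_max_right _ _

theorem runningMax_le {r : ℕ → ℝ} {x : ℝ} {l : ℕ} (h : ∀ k ≤ l, r k ≤ x) :
    runningMax r l ≤ x := by
  induction l with
  | zero => exact h 0 le_rfl
  | succ l ih => exact max_le (ih fun k hk => h k (by omega)) (h _ le_rfl)

/-- It suffices that `ln ln (B / b) ≥ 0`, which follows from `3 * b ≤ B` and `exp 1 < 3`. -/
theorem one_le_gFactor {N : ℕ} {A u c d C D H ε δ σ₀ r₀ : ℝ} (hA : 0 ≤ A) (hc : 0 ≤ c)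
    (hd : 1 ≤ d) (hud : 1 ≤ u * d) (hC : 0 < C) (hD : 0 < D) (hε : 0 < ε)
    (hL : 3 ≤ Real.log (N / δ)) (hσ₀ : 0 < σ₀)
    (hσ : σ₀ ^ 2 ≤ C * ε / (alphaTilde D 1 * Real.log (N / δ)))
    (hN : 1 ≤ N) (hr : 0 < r₀) (hεr : ε * (N : ℝ) ^ 2 ≤ H * r₀ ^ 2) :
    1 ≤ gFactor N δ (upperB A u c d C D H ε N r₀) (lowerB d D σ₀ r₀) := by
  set L := Real.log (N / δ) with hLdef
  have hL0 : 0 < L := by linarith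
  have hN' : (1 : ℝ) ≤ N := by exact_mod_cast hN
  have hH : 0 < H := by
    have : 0 < H * r₀ ^ 2 := lt_of_lt_of_le (by positivity) hεr
    exact pos_of_mul_pos_left this (by positivity)
  have hα : alphaTilde D 1 = 2 * D := by unfold alphaTilde; push_cast; ring
  rw [hα, le_div_iff₀ (by positivity)] at hσ
  have hb : 0 < lowerB d D σ₀ r₀ := by
    unfold lowerB; rw [hα]; positivity
  have hpow : 1 ≤ (2 * u * d) ^ N := one_le_pow₀ (by linarith)
  have hmid : r₀ ^ 2 ≤ 2 * A + u * d * r₀ ^ 2 + 12 * C * D * ε * (2 * c + u * d) * N * (N + 3) := by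
    have h₁ : 0 ≤ 12 * C * D * ε * (2 * c + u * d) * N * (N + 3) := by
      have : 0 ≤ u * d := by linarith
      positivity
    nlinarith [sq_nonneg r₀]
  have hB : 2 * d ^ 2 * C * D * H * r₀ ^ 2 * r₀ ^ 2 ≤ upperB A u c d C D H ε N r₀ := by
    unfold upperB
    calc 2 * d ^ 2 * C * D * H * r₀ ^ 2 * r₀ ^ 2
        = 2 * d ^ 2 * C * D * H * r₀ ^ 2 * r₀ ^ 2 * 1 := (mul_one _).symm
      _ ≤ _ := by gcongr
  have hratio : 3 * lowerB d D σ₀ r₀ ≤ upperB A u c d C D H ε N r₀ := by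
    refine le_trans ?_ hB
    unfold lowerB
    rw [hα]
    -- The factor `3` is the lower bound on `ln (N / δ)`.
    have h₁ : 3 * (σ₀ ^ 2 * (2 * D)) ≤ H * r₀ ^ 2 * C := by
      have hs : σ₀ ^ 2 * (2 * D) * 3 ≤ C * ε :=
        (mul_le_mul_of_nonneg_left hL (by positivity)).trans (by linarith)
      have : ε ≤ H * r₀ ^ 2 := (le_mul_of_one_le_right hε.le (one_le_pow₀ hN')).trans hεr
      nlinarith
    calc 3 * (σ₀ ^ 2 * (2 * D) ^ 2 * d ^ 2 * r₀ ^ 2)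
        = 3 * (σ₀ ^ 2 * (2 * D)) * (2 * D * d ^ 2 * r₀ ^ 2) := by ring
      _ ≤ H * r₀ ^ 2 * C * (2 * D * d ^ 2 * r₀ ^ 2) := by gcongr
      _ = _ := by ring
  have hlog : 1 ≤ Real.log (upperB A u c d C D H ε N r₀ / lowerB d D σ₀ r₀) := by
    rw [Real.le_log_iff_exp_le (by
      apply div_pos (lt_of_lt_of_le _ hratio) hb; positivity)]
    have h₃ : 3 ≤ upperB A u c d C D H ε N r₀ / lowerB d D σ₀ r₀ := (le_div_iff₀ hb).2 hratio
    linarith [Real.exp_one_lt_d9]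
  unfold gFactor
  rw [le_div_iff₀ hL0, one_mul, ← hLdef]
  linarith [Real.log_nonneg hlog]

/-- `J = radiusFactor …` dominates the positive root of `J ^ 2 = 2 P J + Q`. -/
theorem radiusFactor_sq_ge {A u c d C D H C₁ g r₀ : ℝ} (hK : 0 ≤ C * D * H * g) :
    2 * (u * d * C₁ * √(C * D * H * g)) * radiusFactor A u c d C D H C₁ g r₀ +
      (2 * A / r₀ ^ 2 + 48 * c * C * D * H) ≤ radiusFactor A u c d C D H C₁ g r₀ ^ 2 := by
  set J := radiusFactor A u c d C D H C₁ g r₀ with hJ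
  set P := u * d * C₁ * √(C * D * H * g) with hP
  have hPsq : u ^ 2 * d ^ 2 * C₁ ^ 2 * C * D * H * g = P ^ 2 := by
    rw [hP, mul_pow, Real.sq_sqrt hK]; ring
  have h₁ : √(P ^ 2 + 2 * A / r₀ ^ 2 + 48 * c * C * D * H) ≤ J - P := by
    have : P + √(P ^ 2 + 2 * A / r₀ ^ 2 + 48 * c * C * D * H) ≤ J := by
      rw [hJ, radiusFactor, hPsq]; exact le_max_right _ _
    linarith
  have h₂ := (Real.sqrt_le_left ((Real.sqrt_nonneg _).trans h₁)).1 h₁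
  nlinarith

/-- The growth of the step sizes against the decay of the noise levels. -/
theorem sum_sq_mul_sq_le {N : ℕ} {C D ε L : ℝ} {α σ : ℕ → ℝ} (hC : 0 < C) (hD : 0 < D)
    (hε : 0 < ε) (hL : 0 < L) (hα : ∀ k, 0 ≤ α k)
    (hα' : ∀ k, α (k + 1) ≤ alphaTilde D (k + 1))
    (hσ : ∀ k, σ k ^ 2 ≤ C * ε / (alphaTilde D (k + 1) * L)) {l : ℕ} (hl : l ≤ N) :
    ∑ k ∈ Finset.range l, α (k + 1) ^ 2 * σ (k + 1) ^ 2 ≤ 2 * C * D * ε * N ^ 2 / L := by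
  -- Squared steps grow quadratically and the variances decay like `1 / k`, so the terms grow
  -- linearly; `k + 3` is weakened to `k + 2` to cancel.
  have hterm : ∀ k, α (k + 1) ^ 2 * σ (k + 1) ^ 2 ≤ C * D * ε / L * (k + 2) := by
    intro k
    have h₁ := hα' k
    have h₂ := hσ (k + 1)
    unfold alphaTilde at h₁ h₂
    push_cast at h₁ h₂
    calc α (k + 1) ^ 2 * σ (k + 1) ^ 2
        ≤ (D * (k + 1 + 1)) ^ 2 * (C * ε / (D * ((k : ℝ) + 1 + 1 + 1) * L)) := by
          gcongr
          exact hα _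
      _ ≤ (D * (k + 1 + 1)) ^ 2 * (C * ε / (D * ((k : ℝ) + 1 + 1) * L)) := by
          gcongr; linarith
      _ = _ := by field_simp; ring
  have hsum : ∀ l : ℕ, ∑ k ∈ Finset.range l, ((k : ℝ) + 2) ≤ 2 * (l : ℝ) ^ 2 := by
    intro l
    induction l with
    | zero => simp
    | succ l ih =>
      rw [Finset.sum_range_succ]; push_cast
      nlinarith [(Nat.cast_nonneg l : (0 : ℝ) ≤ l)]
  calc _ ≤ ∑ k ∈ Finset.range l, C * D * ε / L * ((k : ℝ) + 2) :=
        Finset.sum_le_sum fun k _ => hterm k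
    _ = C * D * ε / L * ∑ k ∈ Finset.range l, ((k : ℝ) + 2) := by rw [Finset.mul_sum]
    _ ≤ C * D * ε / L * (2 * (N : ℝ) ^ 2) := by
        gcongr
        exact (hsum l).trans (by gcongr)
    _ = _ := by ring

/-! ### Deterministic control of a trajectory -/

section Trajectory

variable {E : Type*} [NormedAddCommGroup E] [InnerProductSpace ℝ E]

/-- The vector `x / ρ`, cut off to zero when its norm exceeds one. -/
noncomputable def truncateRescale (ρ : ℝ) (x : E) : E :=
  if ‖x‖ ≤ ρ then ρ⁻¹ • x else 0

theorem norm_truncateRescale_le (ρ : ℝ) (x : E) : ‖truncateRescale ρ x‖ ≤ 1 := by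
  unfold truncateRescale
  split_ifs with h
  · have hρ : 0 ≤ ρ := (norm_nonneg x).trans h
    rw [norm_smul, norm_inv, Real.norm_of_nonneg hρ, inv_mul_eq_div]
    exact div_le_one_of_le₀ h hρ
  · simp

theorem inner_eq_mul_inner_truncateRescale {ρ : ℝ} (hρ : 0 < ρ) {x : E} (h : ‖x‖ ≤ ρ) (y : E) :
    (inner ℝ y x : ℝ) = ρ * inner ℝ y (truncateRescale ρ x) := by
  rw [truncateRescale, if_pos h, inner_smul_right, mul_inv_cancel_left₀ hρ.ne']

theorem measurable_truncateRescale {Ω : Type*} {_ : MeasurableSpace Ω} [MeasurableSpace E]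
    [BorelSpace E] [SecondCountableTopology E] {ρ : Ω → ℝ} {x : Ω → E} (hρ : Measurable ρ)
    (hx : Measurable x) : Measurable fun ω => truncateRescale (ρ ω) (x ω) :=
  Measurable.ite (measurableSet_le hx.norm hρ) (hρ.inv.smul hx) measurable_const

/-- The radii stay controlled along every trajectory on which the truncated martingale and
the noise are controlled. -/
theorem radius_le_and_sum_le {N : ℕ} {A u c d C D H ε L g : ℝ} {α σ r : ℕ → ℝ} {η a : ℕ → E}
    (hc : 0 ≤ c) (hd : 1 ≤ d) (hud : 1 ≤ u * d) (hC : 0 < C) (hD : 0 < D)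
    (hε : 0 < ε) (hL : 3 ≤ L) (hN : 1 ≤ N) (hg : 1 ≤ g)
    (hα : ∀ k, 0 ≤ α k) (hα' : ∀ k, α (k + 1) ≤ alphaTilde D (k + 1))
    (hσ : ∀ k, σ k ^ 2 ≤ C * ε / (alphaTilde D (k + 1) * L))
    (hr₀ : 0 < r 0) (hεr : ε * (N : ℝ) ^ 2 ≤ H * r 0 ^ 2)
    (hrec : ∀ l ∈ Finset.Icc 1 N, 1 / 2 * r l ^ 2 ≤
      A + u * ∑ k ∈ Finset.range l, α (k + 1) * inner ℝ (η (k + 1)) (a k) +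
        c * ∑ k ∈ Finset.range l, α (k + 1) ^ 2 * ‖η (k + 1)‖ ^ 2)
    (ha : ∀ k, ‖a k‖ ≤ d * runningMax r k)
    (hnoise : ∀ k < N, ‖η (k + 1)‖ ^ 2 ≤ σ (k + 1) ^ 2 * (1 + L))
    (hmart : ∀ l ∈ Finset.Icc 1 N,
      ∑ k ∈ Finset.range l, α (k + 1) * inner ℝ (η (k + 1))
        (truncateRescale (d * (radiusFactor A u c d C D H 3 g (r 0) * r 0)) (a k)) ≤
        2 * √(2 * C * D * ε * N ^ 2)) :
    ∀ l ∈ Finset.Icc 1 N,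
      runningMax r l ≤ radiusFactor A u c d C D H 3 g (r 0) * r 0 ∧
      u * ∑ k ∈ Finset.range l, α (k + 1) * inner ℝ (η (k + 1)) (a k) +
          c * ∑ k ∈ Finset.range l, α (k + 1) ^ 2 * ‖η (k + 1)‖ ^ 2 ≤
        (24 * c * C * D * H +
          u * d * 3 * √(C * D * H * radiusFactor A u c d C D H 3 g (r 0) ^ 2 * g)) * r 0 ^ 2 := by
  have hH : 0 < H := by
    have : 0 < H * r 0 ^ 2 := lt_of_lt_of_le (by positivity) hεr
    exact pos_of_mul_pos_left this (by positivity)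
  have hK : 0 < C * D * H * g := by positivity
  have hJsq := radiusFactor_sq_ge (A := A) (c := c) (r₀ := r 0) (u := u) (d := d)
    (C₁ := 3) hK.le
  have hJ1 : 1 ≤ radiusFactor A u c d C D H 3 g (r 0) := le_max_left _ _
  set J := radiusFactor A u c d C D H 3 g (r 0)
  have hu : 0 < u := pos_of_mul_pos_left (by linarith : 0 < u * d) (by linarith)
  have hd0 : 0 < d := by linarith
  have hJ0 : 0 < J := by linarith
  have hsqrt : √(C * D * H * J ^ 2 * g) = J * √(C * D * H * g) := by
    rw [show C * D * H * J ^ 2 * g = J ^ 2 * (C * D * H * g) by ring, Real.sqrt_mul (sq_nonneg _),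
      Real.sqrt_sq hJ0.le]
  rw [hsqrt]
  set T := √(C * D * H * g)
  have hnoise' : ∀ l ≤ N, ∑ k ∈ Finset.range l, α (k + 1) ^ 2 * ‖η (k + 1)‖ ^ 2 ≤
      24 * C * D * H * r 0 ^ 2 := by
    intro l hl
    calc ∑ k ∈ Finset.range l, α (k + 1) ^ 2 * ‖η (k + 1)‖ ^ 2
        ≤ ∑ k ∈ Finset.range l, α (k + 1) ^ 2 * σ (k + 1) ^ 2 * (1 + L) := by
          refine Finset.sum_le_sum fun k hk => ?_
          rw [mul_assoc]
          gcongr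
          exact hnoise k ((Finset.mem_range.1 hk).trans_le hl)
      _ = (∑ k ∈ Finset.range l, α (k + 1) ^ 2 * σ (k + 1) ^ 2) * (1 + L) := by
          rw [Finset.sum_mul]
      _ ≤ 2 * C * D * ε * N ^ 2 / L * (2 * L) := by
          gcongr
          · exact sum_sq_mul_sq_le hC hD hε (by linarith) hα hα' hσ hl
          · linarith
      _ = 4 * (C * D) * (ε * N ^ 2) := by field_simp; ring
      _ ≤ 4 * (C * D) * (H * r 0 ^ 2) := by gcongr
      -- The argument gives `4`; `24` is the constant of the statement.
      _ ≤ 24 * (C * D) * (H * r 0 ^ 2) := by gcongr; norm_num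
      _ = _ := by ring
  -- Origin of `C₁ = 3`: it is an upper bound for `2 * √2`.
  have hdev : 2 * √(2 * C * D * ε * N ^ 2) ≤ 3 * T * r 0 := by
    have h₁ : √(2 * C * D * ε * N ^ 2) ≤ 3 / 2 * T * r 0 := by
      refine Real.sqrt_le_iff.2 ⟨by positivity, ?_⟩
      rw [mul_pow, mul_pow, Real.sq_sqrt hK.le]
      calc 2 * C * D * ε * N ^ 2 = 2 * (C * D) * (ε * N ^ 2) := by ring
        _ ≤ 9 / 4 * (C * D) * (H * r 0 ^ 2) := by gcongr; norm_num
        _ = 9 / 4 * (C * D) * (H * r 0 ^ 2) * 1 := (mul_one _).symm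
        _ ≤ 9 / 4 * (C * D) * (H * r 0 ^ 2) * g := by gcongr
        _ = _ := by ring
    linarith
  have hsum : ∀ l ∈ Finset.Icc 1 N, (∀ k < l, runningMax r k ≤ J * r 0) →
      u * ∑ k ∈ Finset.range l, α (k + 1) * inner ℝ (η (k + 1)) (a k) +
          c * ∑ k ∈ Finset.range l, α (k + 1) ^ 2 * ‖η (k + 1)‖ ^ 2 ≤
        (24 * c * C * D * H + u * d * 3 * (J * T)) * r 0 ^ 2 := by
    intro l hl hk
    have h₁ : ∑ k ∈ Finset.range l, α (k + 1) * inner ℝ (η (k + 1)) (a k) ≤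
        d * (J * r 0) * (3 * T * r 0) := by
      calc _ = d * (J * r 0) * ∑ k ∈ Finset.range l, α (k + 1) * inner ℝ (η (k + 1))
            (truncateRescale (d * (J * r 0)) (a k)) := by
            rw [Finset.mul_sum]
            refine Finset.sum_congr rfl fun k hkl => ?_
            rw [inner_eq_mul_inner_truncateRescale (ρ := d * (J * r 0)) (by positivity)
              ((ha k).trans (by gcongr; exact hk k (Finset.mem_range.1 hkl)))]
            ring
        _ ≤ _ := by
            gcongr
            exact (hmart l hl).trans hdev
    calc _ ≤ u * (d * (J * r 0) * (3 * T * r 0)) + c * (24 * C * D * H * r 0 ^ 2) := by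
          gcongr
          exact hnoise' l (Finset.mem_Icc.1 hl).2
      _ = _ := by ring
  -- Not circular: the sum up to `l` involves only the vectors `a k`, hence the radii, with `k < l`.
  have hrad : ∀ l ≤ N, runningMax r l ≤ J * r 0 := by
    intro l
    induction l using Nat.strong_induction_on with
    | _ l ih =>
      intro hl
      refine runningMax_le fun k hk => ?_
      rcases hk.lt_or_eq with hk | rfl
      · exact (le_runningMax r k).trans (ih k hk (by omega))
      · rcases Nat.eq_zero_or_pos k with rfl | hpos
        · nlinarith
        · have hmem : k ∈ Finset.Icc 1 N := Finset.mem_Icc.2 ⟨hpos, hl⟩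
          have h₁ := hrec k hmem
          have h₂ := hsum k hmem fun j hj => ih j hj (by omega)
          refine abs_le_of_sq_le_sq' ?_ (by positivity) |>.2
          calc r k ^ 2 ≤ 2 * A + 2 * ((24 * c * C * D * H + u * d * 3 * (J * T)) * r 0 ^ 2) := by
                linarith
            _ = (2 * (u * d * 3 * T) * J + (2 * A / r 0 ^ 2 + 48 * c * C * D * H)) * r 0 ^ 2 := by
                field_simp; ring
            _ ≤ J ^ 2 * r 0 ^ 2 := by gcongr
            _ = _ := by ring
  exact fun l hl => ⟨hrad l (Finset.mem_Icc.1 hl).2, hsum l hl fun k hk =>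
    hrad k (hk.le.trans (Finset.mem_Icc.1 hl).2)⟩

end Trajectory

/-! ### Assembly of the probabilistic statement -/

theorem measurable_radiusFactor (N : ℕ) (A u c d C D H ε δ σ₀ C₁ : ℝ) :
    Measurable fun r₀ => radiusFactor A u c d C D H C₁
      (gFactor N δ (upperB A u c d C D H ε N r₀) (lowerB d D σ₀ r₀)) r₀ := by
  unfold radiusFactor gFactor upperB lowerB
  fun_prop

theorem measure_biUnion_le_of_le_div {Ω : Type*} [MeasurableSpace Ω] {μ : Measure Ω} {N : ℕ}
    (hN : 1 ≤ N) {δ : ℝ} {s : Finset ℕ} (hs : s.card = N) {B : ℕ → Set Ω}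
    (h : ∀ k ∈ s, μ (B k) ≤ ENNReal.ofReal (δ / N)) :
    μ (⋃ k ∈ s, B k) ≤ ENNReal.ofReal δ := by
  have hN' : (N : ℝ) ≠ 0 := by positivity
  calc _ ≤ ∑ k ∈ s, μ (B k) := measure_biUnion_finset_le _ _
    _ ≤ ∑ _k ∈ s, ENNReal.ofReal (δ / N) := Finset.sum_le_sum h
    _ = ENNReal.ofReal δ := by
      rw [Finset.sum_const, hs, nsmul_eq_mul, ← ENNReal.ofReal_natCast,
        ← ENNReal.ofReal_mul (by positivity), mul_div_cancel₀ _ hN']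

theorem lemma3 :
    ∃ C₁ : ℝ, 0 < C₁ ∧
      ∀ (n : ℕ) (Ω : Type*) [MeasurableSpace Ω] (μ : Measure Ω) [IsProbabilityMeasure μ]
        (N : ℕ) (A u c d C D H ε δ : ℝ) (α σ : ℕ → ℝ) (R : ℕ → Ω → ℝ)
        (η a : ℕ → Ω → EuclideanSpace ℝ (Fin n)),
        0 ≤ A → 0 ≤ c → 1 ≤ d → 1 ≤ u * d → 0 < C → 0 < D → 0 < ε → 0 < δ →
        3 ≤ Real.log (N / δ) →
        -- the step sizes and the noise levels
        (∀ k, 0 ≤ α k) →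
        (∀ k, α (k + 1) ≤ alphaTilde D (k + 1)) →
        (∀ k, 0 < σ k) →
        (∀ k, σ k ^ 2 ≤ C * ε / (alphaTilde D (k + 1) * Real.log (N / δ))) →
        -- the radii, and the recurrence that they satisfy
        (∀ k, Measurable (R k)) →
        (∀ k, ∀ᵐ ω ∂μ, 0 ≤ R k ω) →
        (∀ k, Measurable[sigmaBefore η (k + 1)] (fun ω => runningMax (fun j => R j ω) k)) →
        (∀ l ∈ Finset.Icc 1 N, ∀ᵐ ω ∂μ,
          1 / 2 * R l ω ^ 2 ≤
            A + u * ∑ k ∈ Finset.range l, α (k + 1) * inner ℝ (η (k + 1) ω) (a k ω) +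
              c * ∑ k ∈ Finset.range l, α (k + 1) ^ 2 * ‖η (k + 1) ω‖ ^ 2) →
        (∀ᵐ ω ∂μ, ε ≤ H * R 0 ω ^ 2 / (N : ℝ) ^ 2) →
        -- the vectors `a k`
        (∀ k, Measurable[sigmaBefore η (k + 1)] (a k)) →
        (∀ k, ∀ᵐ ω ∂μ, ‖a k ω‖ ≤ d * runningMax (fun j => R j ω) k) →
        -- the noise: martingale differences with light tails
        (∀ k, Measurable (η k)) →
        (∀ k, μ[η k | sigmaBefore η k] =ᵐ[μ] 0) →
        (∀ k, Integrable (fun ω => Real.exp (‖η k ω‖ ^ 2 / σ k ^ 2)) μ) →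
        (∀ k, ∀ᵐ ω ∂μ,
          (μ[fun ω' => Real.exp (‖η k ω'‖ ^ 2 / σ k ^ 2) | sigmaBefore η k]) ω ≤ Real.exp 1) →
        ENNReal.ofReal (1 - 2 * δ) ≤
          μ {ω |
            let g := gFactor N δ (upperB A u c d C D H ε N (R 0 ω)) (lowerB d D (σ 0) (R 0 ω))
            let J := radiusFactor A u c d C D H C₁ g (R 0 ω)
            ∀ l ∈ Finset.Icc 1 N,
              runningMax (fun j => R j ω) l ≤ J * R 0 ω ∧
              u * ∑ k ∈ Finset.range l, α (k + 1) * inner ℝ (η (k + 1) ω) (a k ω) +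
                  c * ∑ k ∈ Finset.range l, α (k + 1) ^ 2 * ‖η (k + 1) ω‖ ^ 2 ≤
                (24 * c * C * D * H + u * d * C₁ * √(C * D * H * J ^ 2 * g)) * R 0 ω ^ 2} := by
  refine ⟨3, by norm_num, ?_⟩
  intro n Ω _ μ _ N A u c d C D H ε δ α σ R η a hA hc hd hud hC hD hε hδ hL hα hα' hσ₀ hσ _ hR
    hRmeas hrec hεR ha_meas ha hη hmean hexp htail
  have hN : 1 ≤ N := by
    -- For `N = 0` the logarithm takes its default value `log 0 = 0`, against `3 ≤ L`.
    rcases Nat.eq_zero_or_pos N with rfl | h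
    · norm_num at hL
    · exact h
  have hN' : (0 : ℝ) < N := by exact_mod_cast hN
  have hexpL : Real.exp (-Real.log (N / δ)) = δ / N := by
    rw [Real.exp_neg, Real.exp_log (by positivity), inv_div]
  set L := Real.log (N / δ) with hLdef
  have hL0 : 0 < L := by linarith
  -- The cut-off level is random, but only through `R 0`, which is known from `η 0`; the cut-off
  -- vectors therefore stay adapted.
  set ρ : ℝ → ℝ := fun r₀ => d * (radiusFactor A u c d C D H 3
    (gFactor N δ (upperB A u c d C D H ε N r₀) (lowerB d D (σ 0) r₀)) r₀ * r₀)
  have hρ : Measurable ρ :=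
    ((measurable_radiusFactor N A u c d C D H ε δ (σ 0) 3).mul measurable_id).const_mul d
  set W : ℝ := 2 * C * D * ε * N ^ 2
  have hW : 0 < W := by positivity
  -- Chosen so that the variance term `t ^ 2 * (W / L)` equals `L`; the threshold `2 * L` then
  -- leaves `exp (-L) = δ / N`.
  set t : ℝ := L / √W
  have ht : 0 < t := div_pos hL0 (Real.sqrt_pos.2 hW)
  set w : ℕ → Ω → EuclideanSpace ℝ (Fin n) := fun k ω => truncateRescale (ρ (R 0 ω)) (a k ω)
  have hw_meas : ∀ k, Measurable[sigmaBefore η (k + 1)] (w k) := fun k =>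
    measurable_truncateRescale (hρ.comp ((hRmeas 0).mono (sigmaBefore_mono (by omega)) le_rfl))
      (ha_meas k)
  have hvar : ∀ l ≤ N, ∑ k ∈ Finset.range l, (t * α (k + 1)) ^ 2 * σ (k + 1) ^ 2 ≤ L := by
    intro l hl
    calc ∑ k ∈ Finset.range l, (t * α (k + 1)) ^ 2 * σ (k + 1) ^ 2
        = t ^ 2 * ∑ k ∈ Finset.range l, α (k + 1) ^ 2 * σ (k + 1) ^ 2 := by
          rw [Finset.mul_sum]
          exact Finset.sum_congr rfl fun k _ => by ring
      _ ≤ t ^ 2 * (W / L) := by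
          gcongr
          exact sum_sq_mul_sq_le hC hD hε hL0 hα hα' hσ hl
      _ = L := by
          rw [div_pow, Real.sq_sqrt hW.le]
          field_simp
  have hmart : μ (⋃ l ∈ Finset.Icc 1 N, {ω | 2 * L <
      ∑ k ∈ Finset.range l, inner ℝ (η (k + 1) ω) ((t * α (k + 1)) • w k ω)}) ≤
      ENNReal.ofReal δ := by
    refine measure_biUnion_le_of_le_div hN (by simp) fun l hl => ?_
    refine (measure_sum_inner_gt_le hσ₀ hη hmean hexp htail
      (v := fun k ω => (t * α (k + 1)) • w k ω) (β := fun k => t * α (k + 1))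
      (fun k => (hw_meas k).const_smul (t * α (k + 1))) (fun k ω => ?_) l (2 * L)).trans
      (ENNReal.ofReal_le_ofReal ?_)
    · have h0 : 0 ≤ t * α (k + 1) := mul_nonneg ht.le (hα _)
      rw [norm_smul, Real.norm_of_nonneg h0]
      exact mul_le_of_le_one_right h0 (norm_truncateRescale_le _ _)
    · rw [← hexpL]
      gcongr
      linarith [hvar l (Finset.mem_Icc.1 hl).2]
  have hnoise : μ (⋃ k ∈ Finset.range N,
      {ω | σ (k + 1) ^ 2 * (1 + L) < ‖η (k + 1) ω‖ ^ 2}) ≤ ENNReal.ofReal δ := by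
    refine measure_biUnion_le_of_le_div hN (by simp) fun k _ => ?_
    rw [← hexpL]
    exact measure_sq_norm_gt_le (sigmaBefore_le hη (k + 1)) (hσ₀ _) (hexp _) (htail _)
  set bad : Set Ω := (⋃ l ∈ Finset.Icc 1 N, {ω | 2 * L <
      ∑ k ∈ Finset.range l, inner ℝ (η (k + 1) ω) ((t * α (k + 1)) • w k ω)}) ∪
    ⋃ k ∈ Finset.range N, {ω | σ (k + 1) ^ 2 * (1 + L) < ‖η (k + 1) ω‖ ^ 2} with hbad
  have hbad_le : μ bad ≤ ENNReal.ofReal (2 * δ) := by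
    refine (measure_union_le _ _).trans ((add_le_add hmart hnoise).trans_eq ?_)
    rw [← ENNReal.ofReal_add hδ.le hδ.le, two_mul]
  have hgood_le : ENNReal.ofReal (1 - 2 * δ) ≤ μ badᶜ := by
    rw [ENNReal.ofReal_sub _ (by positivity), ENNReal.ofReal_one, tsub_le_iff_right]
    calc 1 = μ Set.univ := measure_univ.symm
      _ = μ (badᶜ ∪ bad) := by rw [Set.compl_union_self]
      _ ≤ μ badᶜ + μ bad := measure_union_le _ _
      _ ≤ _ := by gcongr
  refine hgood_le.trans (measure_mono_ae ?_)
  have hrec' : ∀ᵐ ω ∂μ, ∀ l ∈ Finset.Icc 1 N, 1 / 2 * R l ω ^ 2 ≤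
      A + u * ∑ k ∈ Finset.range l, α (k + 1) * inner ℝ (η (k + 1) ω) (a k ω) +
        c * ∑ k ∈ Finset.range l, α (k + 1) ^ 2 * ‖η (k + 1) ω‖ ^ 2 :=
    (Finset.eventually_all _).2 hrec
  filter_upwards [hrec', ae_all_iff.2 hR, ae_all_iff.2 ha, hεR] with ω h_rec h_R h_a h_εR hω
  have hεr : ε * (N : ℝ) ^ 2 ≤ H * R 0 ω ^ 2 := (le_div_iff₀ (by positivity)).1 h_εR
  have hr₀ : 0 < R 0 ω := by
    refine (h_R 0).lt_of_ne fun h => ?_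
    rw [← h] at hεr
    have : 0 < ε * (N : ℝ) ^ 2 := by positivity
    norm_num at hεr
    linarith
  replace hω : ω ∉ bad := hω
  simp only [hbad, Set.mem_union, Set.mem_iUnion, Set.mem_ofPred_eq, not_or, not_exists,
    not_lt, Finset.mem_range] at hω
  obtain ⟨h_mart, h_noise⟩ := hω
  refine radius_le_and_sum_le (r := fun j => R j ω) (η := fun k => η k ω) (a := fun k => a k ω)
    hc hd hud hC hD hε hL hN
    (one_le_gFactor hA hc hd hud hC hD hε hL (hσ₀ 0) (hσ 0) hN hr₀ hεr)
    hα hα' hσ hr₀ hεr h_rec h_a h_noise fun l hl => ?_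
  have h := h_mart l hl
  simp only [inner_smul_right, mul_assoc] at h
  rw [← Finset.mul_sum] at h
  calc _ ≤ 2 * L / t := (le_div_iff₀' ht).2 h
    _ = 2 * √W := by
      rw [div_div_eq_mul_div]
      field_simp
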